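/- Let $\mathcal F$ be the singular foliation of $\mathbb C^3$ defined by the vector field $$X = x(1+x^2yz^3)\,\partial_x + y(1-x^2yz^3)\,\partial_y - z\,\partial_z .$$ A holomorphic first integral on an open set $U$ is a holomorphic function $F:U\to\mathbb C$ with $dF(X)=0$ on $U$; two first integrals $F,G$ on a connected open set are independent if $dF\wedge dG\not\equiv 0$. Let $\mathrm{Diff}(\mathbb C^2,0)$ be the group of germs of local holomorphic diffeomorphisms of $\mathbb C^2$ fixing the origin. A germ $h\in \mathrm{Diff}(\mathbb C^2,0)$ has finite orbits if there is an open neighbourhood $V$ of $0$, on which $h$ and $h^{-1}$ have injective holomorphic representatives, such that every orbit in $V$ is finite, the orbit of $p\in V$ being the set of points reached from $p$ by successive applications of $h^{\pm1}$ with all successive points in $V$. Then: (i) On no connected open neighbourhood of the origin does $\mathcal F$ have two independent holomorphic first integrals; it does have a holomorphic first integral on all of $\mathbb C^3$ that is non-constant on every neighbourhood of the origin. (ii) Let $h\in\mathrm{Diff}(\mathbb C^2,0)$ be the holonomy germ of $\mathcal F$ along the $z$-axis $\{x=y=0\}$, on the transversal $\{z=1\}$, for the loop $z=e^{2\pi i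 t}$, $0\le t\le 1$; the holonomy germ of the reversed loop $z=e^{-2\pi i t}$ is $h^{-1}$. Both have the form $$(x,y)\mapsto\left(x\,(1+x^2y\,f(x^2y)),\; y\,(1+x^2y\,f(x^2y))^{-1}\right)$$ near the origin, with $f$ a function of one variable holomorphic near $0$, where $f(0)=-2\pi i$ for $h$ and $f(0)=2\pi i$ for $h^{-1}$. (iii) $h$ and $h^{-1}$ have finite orbits, but $h$ is not periodic (no power $h^k$, $k\ge1$, is the identity germ) and the subgroup of $\mathrm{Diff}(\mathbb C^2,0)$ generated by $h$ is infinite. -/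

import Mathlib

open Set Filter Topology

noncomputable section

/-! ### Germs of local holomorphic diffeomorphisms fixing the origin -/

section Germs

variable (E : Type*) [NormedAddCommGroup E] [NormedSpace ℂ E]

/-- Maps that are holomorphic near `0` and fix `0`. -/
abbrev LocalHolMap : Type _ := {f : E → E // AnalyticAt ℂ f 0 ∧ f 0 = 0}

/-- Two such maps are identified when they agree on a neighbourhood of `0`. -/
instance LocalHolMap.setoid : Setoid (LocalHolMap E) where
  r f g := f.1 =ᶠ[𝓝 0] g.1
  iseqv := ⟨fun _ => EventuallyEq.rfl, fun h => h.symm, fun h₁ h₂ => h₁.trans h₂⟩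

/-- Germs at `0` of holomorphic maps fixing `0`. -/
def HolGerm : Type _ := Quotient (LocalHolMap.setoid E)

variable {E}

/-- Composition of representatives. -/
def LocalHolMap.comp (f g : LocalHolMap E) : LocalHolMap E :=
  ⟨f.1 ∘ g.1,
    AnalyticAt.comp (by rw [g.2.2]; exact f.2.1) g.2.1,
    by simp only [Function.comp_apply, g.2.2, f.2.2]⟩

/-- Germs form a monoid under composition. -/
instance HolGerm.instMonoid : Monoid (HolGerm E) where
  mul := Quotient.map₂ LocalHolMap.comp (by
    intro f f' hf g g' hg
    have ht : Tendsto g.1 (𝓝 0) (𝓝 0) := by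
      have h := g.2.1.continuousAt.tendsto
      rwa [g.2.2] at h
    have h1 : ∀ᶠ x in 𝓝 (0 : E), f.1 (g.1 x) = f'.1 (g.1 x) := ht.eventually hf
    have h2 : ∀ᶠ x in 𝓝 (0 : E), g.1 x = g'.1 x := hg
    show ∀ᶠ x in 𝓝 (0 : E), f.1 (g.1 x) = f'.1 (g'.1 x)
    filter_upwards [h1, h2] with x hx1 hx2
    rw [hx1, hx2])
  one := Quotient.mk _ ⟨id, analyticAt_id, rfl⟩
  mul_assoc := by rintro ⟨f⟩ ⟨g⟩ ⟨k⟩; rfl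
  one_mul := by rintro ⟨f⟩; rfl
  mul_one := by rintro ⟨f⟩; rfl

variable (E) in
/-- The group `Diff(E, 0)` of germs of local holomorphic diffeomorphisms of `E` fixing the origin:
the germs that are invertible under composition. -/
abbrev DiffGerm : Type _ := (HolGerm E)ˣ

/-- The map `φ` is a representative of the germ `h`. -/
def DiffGerm.IsRepresentedBy (h : DiffGerm E) (φ : E → E) : Prop :=
  ∃ hφ : AnalyticAt ℂ φ 0 ∧ φ 0 = 0, h.val = Quotient.mk (LocalHolMap.setoid E) ⟨φ, hφ⟩

/-- The orbit of `p` under the pseudogroup on `V` generated by `φ` and its inverse `ψ`: all points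
obtained from `p` by words in `φ`, `ψ` whose successive images stay in `V`. -/
def pseudoOrbit (V : Set E) (φ ψ : E → E) (p : E) : Set E :=
  {q | Relation.ReflTransGen (fun a b => b ∈ V ∧ (b = φ a ∨ b = ψ a)) p q}

/-- The germ `h` has finite orbits: on some open neighbourhood `V` of the origin on which `h` and
its inverse are represented by injective holomorphic maps, inverse to each other as long as points
stay in `V`, every orbit of the pseudogroup generated by `h` on `V` is finite. -/
def DiffGerm.HasFiniteOrbits (h : DiffGerm E) : Prop :=
  ∃ (V : Set E) (φ ψ : E → E), IsOpen V ∧ (0 : E) ∈ V ∧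
    h.IsRepresentedBy φ ∧ h⁻¹.IsRepresentedBy ψ ∧
    DifferentiableOn ℂ φ V ∧ DifferentiableOn ℂ ψ V ∧ InjOn φ V ∧ InjOn ψ V ∧
    (∀ p ∈ V, φ p ∈ V → ψ (φ p) = p) ∧ (∀ p ∈ V, ψ p ∈ V → φ (ψ p) = p) ∧
    ∀ p ∈ V, (pseudoOrbit V φ ψ p).Finite

end Germs

/-! ### Foliations by curves on `ℂ³`: first integrals and holonomy along the third axis -/

/-- `F` is a holomorphic function on `U`, constant along the leaves of the foliation of `X`,
that is `dF(X) = 0`. (Constant functions are allowed.) -/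
def IsFirstIntegralOn (X : ℂ × ℂ × ℂ → ℂ × ℂ × ℂ) (U : Set (ℂ × ℂ × ℂ))
    (F : ℂ × ℂ × ℂ → ℂ) : Prop :=
  DifferentiableOn ℂ F U ∧ ∀ p ∈ U, fderiv ℂ F p (X p) = 0

/-- The 2-form `dF ∧ dG` does not vanish identically on `U` (for connected `U`). -/
def IndependentOn (U : Set (ℂ × ℂ × ℂ)) (F G : ℂ × ℂ × ℂ → ℂ) : Prop :=
  ∃ p ∈ U, LinearIndependent ℂ ![fderiv ℂ F p, fderiv ℂ G p]

/-- `h` is the holonomy germ, for the foliation of `X`, of the loop `t ↦ (0, 0, γ t)`, `t ∈ [0,1]`,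
in the third axis, on the transversal `{z = γ 0} ≃ ℂ²`. For `p` near `0`,
`t ↦ (Γ p t, γ t)` is the lift of the loop to the leaf through `(p, γ 0)` (its velocity is a
multiple of `X`), the lifts depend continuously on `p`, the lift of `p = 0` is the loop itself,
and the lift of `p` ends at `(h p, γ 1)`. -/
def IsHolonomyGerm (X : ℂ × ℂ × ℂ → ℂ × ℂ × ℂ) (γ : ℝ → ℂ) (h : DiffGerm (ℂ × ℂ)) : Prop :=
  ∃ (φ : ℂ × ℂ → ℂ × ℂ) (V : Set (ℂ × ℂ)) (Γ : ℂ × ℂ → ℝ → ℂ × ℂ),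
    h.IsRepresentedBy φ ∧ V ∈ 𝓝 (0 : ℂ × ℂ) ∧
    ContinuousOn (fun q : (ℂ × ℂ) × ℝ => Γ q.1 q.2) (V ×ˢ Icc (0 : ℝ) 1) ∧
    (∀ t ∈ Icc (0 : ℝ) 1, Γ 0 t = 0) ∧
    ∀ p ∈ V, Γ p 0 = p ∧ Γ p 1 = φ p ∧
      ∀ t ∈ Icc (0 : ℝ) 1, ∃ c : ℂ,
        HasDerivWithinAt (fun s : ℝ => ((Γ p s).1, (Γ p s).2, γ s))
          (c • X ((Γ p t).1, (Γ p t).2, γ t)) (Icc (0 : ℝ) 1) t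

/-- The vector field
`x(1 + x²yz³) ∂/∂x + y(1 - x²yz³) ∂/∂y - z ∂/∂z` on `ℂ³`. -/
def fieldX : ℂ × ℂ × ℂ → ℂ × ℂ × ℂ := fun p =>
  (p.1 * (1 + p.1 ^ 2 * p.2.1 * p.2.2 ^ 3),
   p.2.1 * (1 - p.1 ^ 2 * p.2.1 * p.2.2 ^ 3),
   -p.2.2)

/-- The germ `h` is `(x, y) ↦ (x(1 + x²y f(x²y)), y(1 + x²y f(x²y))⁻¹)` near the origin, for some
function `f` holomorphic near `0 ∈ ℂ` with `f 0 = a`. -/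
def HasShearForm (h : DiffGerm (ℂ × ℂ)) (a : ℂ) : Prop :=
  ∃ f : ℂ → ℂ, AnalyticAt ℂ f 0 ∧ f 0 = a ∧
    h.IsRepresentedBy (fun p : ℂ × ℂ =>
      (p.1 * (1 + p.1 ^ 2 * p.2 * f (p.1 ^ 2 * p.2)),
       p.2 * (1 + p.1 ^ 2 * p.2 * f (p.1 ^ 2 * p.2))⁻¹))

end

/-!
The resonant monomial `w = x²yz³` satisfies `X(w) = w²`, so the flow of `X` is explicit: at time
`τ` it multiplies `(x, y, z)` by `(exp τ, exp τ, exp (-τ))` and then squeezes `(x, y)` to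
`(x / (1 - wτ), y (1 - wτ))`. For `exp τ = 1` only the squeezing is left, which gives the holonomy
`(x, y) ↦ (x / (1 - cx²y), y (1 - cx²y))` with `c = ∓2πi`. It preserves `xy` and moves `y` by
multiples of `c(xy)²`, so only finitely many points of an orbit lie in a bounded region, although
no power of it is the identity.

A first integral `F` near the origin is invariant under the holonomy of every multiple of the loop.
By the identity theorem it is then invariant under all small squeezings, so that `dF` annihilates
`x ∂/∂x - y ∂/∂y` as well as `X`, and is a multiple of `d(xyz²)` on a nonempty open set. Hence
`dF ∧ dG` vanishes there for any two first integrals, and everywhere by the identity theorem.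
-/

section ComplexAnalysis

variable {E F : Type*} [NormedAddCommGroup E] [NormedSpace ℂ E] [NormedAddCommGroup F]
  [NormedSpace ℂ F]

theorem uniformCauchySeqOn_fderiv {ι : Type*} {l : Filter ι} {f : ι → E → F} {U K : Set E} {ρ : ℝ}
    (hf : ∀ᶠ i in l, DifferentiableOn ℂ (f i) U) (h : UniformCauchySeqOn f l U)
    (hρ : 0 < ρ) (hK : ∀ p ∈ K, Metric.ball p ρ ⊆ U) :
    UniformCauchySeqOn (fun i => fderiv ℂ (f i)) l K := by
  rw [SeminormedAddGroup.uniformCauchySeqOn_iff_tendstoUniformlyOn_zero,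
    Metric.tendstoUniformlyOn_iff] at h ⊢
  intro ε hε
  filter_upwards [h (ε * ρ / 4) (by positivity), hf.prod_mk hf] with ij hclose hdiff p hp
  have hball := hK p hp
  have hi := hdiff.1.mono hball
  have hj := hdiff.2.mono hball
  have hnhds := Metric.ball_mem_nhds p hρ
  have hbound : ∀ q ∈ Metric.ball p ρ, ‖(f ij.1 - f ij.2) q‖ ≤ ε * ρ / 4 := fun q hq => by
    have hlt := hclose q (hball hq)
    rw [Pi.zero_apply, dist_zero_left, neg_add_eq_sub, norm_sub_rev] at hlt
    exact hlt.le
  have hmaps : MapsTo (f ij.1 - f ij.2) (Metric.ball p ρ)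
      (Metric.closedBall ((f ij.1 - f ij.2) p) (ε * ρ / 2)) := fun q hq => by
    rw [mem_closedBall_iff_norm]
    linarith [norm_sub_le ((f ij.1 - f ij.2) q) ((f ij.1 - f ij.2) p), hbound q hq,
      hbound p (Metric.mem_ball_self hρ)]
  have cauchy := Complex.norm_fderiv_le_div_of_mapsTo_ball (hi.sub hj) hmaps hρ
  rw [fderiv_sub (hi.differentiableAt hnhds) (hj.differentiableAt hnhds)] at cauchy
  rw [Pi.zero_apply, dist_zero_left, neg_add_eq_sub, norm_sub_rev]
  refine cauchy.trans_lt ?_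
  rw [div_lt_iff₀ hρ]
  linarith [mul_pos hε hρ]

theorem differentiableOn_of_tendstoUniformlyOn [CompleteSpace F] {ι : Type*} {l : Filter ι}
    [l.NeBot] {f : ι → E → F} {g : E → F} {U : Set E} (hU : IsOpen U)
    (hf : ∀ᶠ i in l, DifferentiableOn ℂ (f i) U) (h : TendstoUniformlyOn f g l U) :
    DifferentiableOn ℂ g U := by
  intro a ha
  obtain ⟨R, hR, hball⟩ := Metric.isOpen_iff.1 hU a ha
  have hsub : ∀ p ∈ Metric.ball a (R / 2), Metric.ball p (R / 2) ⊆ U := fun p hp =>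
    (Metric.ball_subset_ball' (by linarith [Metric.mem_ball.1 hp])).trans hball
  have hcauchy : UniformCauchySeqOn (fun i => fderiv ℂ (f i)) l (Metric.ball a (R / 2)) :=
    uniformCauchySeqOn_fderiv hf h.uniformCauchySeqOn (half_pos hR) hsub
  have hlim : ∀ p, ∃ g', p ∈ Metric.ball a (R / 2) →
      Tendsto (fun i => fderiv ℂ (f i) p) l (𝓝 g') := fun p => by
    by_cases hp : p ∈ Metric.ball a (R / 2)
    · exact (CompleteSpace.complete (hcauchy.cauchy_map hp)).imp fun _ h _ => h
    · exact ⟨0, fun h => absurd h hp⟩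
  choose g' hg' using hlim
  have hunif : TendstoUniformlyOn (fun i => fderiv ℂ (f i)) g' l (Metric.ball a (R / 2)) :=
    hcauchy.tendstoUniformlyOn_of_tendsto hg'
  have hmem : Metric.ball a (R / 2) ∈ 𝓝 a := Metric.ball_mem_nhds a (half_pos hR)
  refine DifferentiableAt.differentiableWithinAt ?_
  refine (hasFDerivAt_of_tendstoUniformlyOnFilter (f := f) (f' := fun i => fderiv ℂ (f i))
    (g' := g') (l := l) ?_ ?_ ?_).differentiableAt
  · exact hunif.tendstoUniformlyOnFilter.mono_right (le_principal_iff.2 hmem)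
  · filter_upwards [hf.prod_mk (hU.mem_nhds ha)] with ip hip
    exact (hip.1.differentiableAt (hU.mem_nhds hip.2)).hasFDerivAt
  · filter_upwards [hU.mem_nhds ha] with p hp using h.tendsto_at hp

theorem norm_taylor_remainder_le {f : E → F} {p v : E} {R M : ℝ}
    (hf : DifferentiableOn ℂ f (Metric.ball p R)) (hM : ∀ q ∈ Metric.ball p R, ‖f q - f p‖ ≤ M)
    (hv : ‖v‖ < R) : ‖f (p + v) - f p - fderiv ℂ f p v‖ ≤ 2 * M * (‖v‖ / R) ^ 2 := by
  have hR : 0 < R := (norm_nonneg v).trans_lt hv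
  have cauchy : ‖fderiv ℂ f p‖ ≤ M / R :=
    Complex.norm_fderiv_le_div_of_mapsTo_ball hf
      (fun q hq => mem_closedBall_iff_norm.2 (hM q hq)) hR
  set k : E → F := fun q => f q - f p - fderiv ℂ f p (q - p) with hk
  have hkp : k p = 0 := by simp [hk]
  have hmaps : MapsTo k (Metric.ball p R) (Metric.closedBall (k p) (2 * M)) := by
    intro q hq
    have hlin : ‖fderiv ℂ f p (q - p)‖ ≤ M / R * R :=
      (fderiv ℂ f p).le_of_opNorm_le_of_le cauchy (mem_ball_iff_norm.1 hq).le
    rw [div_mul_cancel₀ _ hR.ne'] at hlin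
    rw [hkp, mem_closedBall_zero_iff]
    exact (norm_sub_le _ _).trans (by linarith [hM q hq])
  have hlittle : (k · - k p) =o[𝓝 p] (fun q => ‖q - p‖ ^ 1) := by
    simp only [hkp, sub_zero, pow_one]
    exact (hasFDerivAt_iff_isLittleO.1
      (hf.differentiableAt (Metric.ball_mem_nhds p hR)).hasFDerivAt).norm_right
  have schwarz := Complex.dist_le_mul_div_pow_of_mapsTo_ball_of_isLittleO (z := p + v)
    (by fun_prop) hmaps hlittle (by simpa using hv)
  simpa [hkp, hk] using schwarz

theorem tendstoUniformlyOn_difference_quotient {f : E → F} {V : Set E} {R M : ℝ} (hR : 0 < R)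
    (hf : ∀ p ∈ V, DifferentiableOn ℂ f (Metric.ball p R))
    (hM : ∀ p ∈ V, ∀ q ∈ Metric.ball p R, ‖f q - f p‖ ≤ M) (v : E) :
    TendstoUniformlyOn (fun (t : ℂ) p => t⁻¹ • (f (p + t • v) - f p))
      (fun p => fderiv ℂ f p v) (𝓝[≠] 0) V := by
  have hsmall : ∀ᶠ t : ℂ in 𝓝 0, ‖t • v‖ < R :=
    ContinuousAt.eventually_lt (by fun_prop) continuousAt_const (by simpa using hR)
  rw [Metric.tendstoUniformlyOn_iff]
  intro ε hε
  have hε' : ∀ᶠ t : ℂ in 𝓝 0, 2 * M * (‖v‖ / R) ^ 2 * ‖t‖ < ε :=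
    ContinuousAt.eventually_lt (by fun_prop) continuousAt_const (by simpa using hε)
  filter_upwards [nhdsWithin_le_nhds hsmall, nhdsWithin_le_nhds hε', self_mem_nhdsWithin]
    with t ht htε ht0 p hp
  have ht0 : t ≠ 0 := ht0
  have hquot : t⁻¹ • (f (p + t • v) - f p) - fderiv ℂ f p v =
      t⁻¹ • (f (p + t • v) - f p - fderiv ℂ f p (t • v)) := by
    rw [map_smul, smul_sub _ _ (t • _), inv_smul_smul₀ ht0]
  rw [dist_comm, dist_eq_norm_sub, hquot, norm_smul, norm_inv]
  refine lt_of_le_of_lt ?_ htε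
  rw [inv_mul_le_iff₀ (norm_pos_iff.2 ht0)]
  refine (norm_taylor_remainder_le (hf p hp) (hM p hp) ht).trans_eq ?_
  rw [norm_smul]
  ring

theorem differentiableOn_fderiv_apply [CompleteSpace F] {f : E → F} {U : Set E} (hU : IsOpen U)
    (hf : DifferentiableOn ℂ f U) (v : E) : DifferentiableOn ℂ (fun p => fderiv ℂ f p v) U := by
  intro a ha
  obtain ⟨R, hR, hball⟩ := Metric.eventually_nhds_iff_ball.1 ((hU.eventually_mem ha).and
    (Metric.tendsto_nhds.1 (hf.differentiableAt (hU.mem_nhds ha)).continuousAt 1 one_pos))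
  have hsub : ∀ p ∈ Metric.ball a (R / 2), Metric.ball p (R / 2) ⊆ Metric.ball a R := fun p hp =>
    Metric.ball_subset_ball' (by linarith [Metric.mem_ball.1 hp])
  have hosc : ∀ p ∈ Metric.ball a (R / 2), ∀ q ∈ Metric.ball p (R / 2), ‖f q - f p‖ ≤ 2 :=
    fun p hp q hq => by
      have hqa := (hball q (hsub p hp hq)).2
      have hpa := (hball p (hsub p hp (Metric.mem_ball_self (half_pos hR)))).2
      rw [← dist_eq_norm_sub]
      linarith [dist_triangle_right (f q) (f p) (f a)]
  have hfR : DifferentiableOn ℂ f (Metric.ball a R) := hf.mono fun q hq => (hball q hq).1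
  have hsmall : ∀ᶠ t : ℂ in 𝓝 0, ‖t • v‖ < R / 2 :=
    ContinuousAt.eventually_lt (by fun_prop) continuousAt_const (by simpa using half_pos hR)
  have hquot := tendstoUniformlyOn_difference_quotient (half_pos hR)
    (fun p hp => hfR.mono (hsub p hp)) hosc v
  have hdiff : ∀ᶠ t : ℂ in 𝓝[≠] 0, DifferentiableOn ℂ (fun p => t⁻¹ • (f (p + t • v) - f p))
      (Metric.ball a (R / 2)) := by
    filter_upwards [nhdsWithin_le_nhds hsmall] with t ht
    have hshift : MapsTo (fun p => p + t • v) (Metric.ball a (R / 2)) (Metric.ball a R) :=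
      fun p hp => hsub p hp (by simpa using ht)
    exact ((hfR.comp (by fun_prop) hshift).sub
      (hfR.mono (Metric.ball_subset_ball (by linarith)))).const_smul _
  exact ((differentiableOn_of_tendstoUniformlyOn Metric.isOpen_ball hdiff hquot).differentiableAt
    (Metric.ball_mem_nhds a (half_pos hR))).differentiableWithinAt

theorem eq_zero_of_frequently_lineMap_eq_zero [CompleteSpace F] {f : E → F} {C : Set E}
    (hC : IsOpen C) (hconv : Convex ℝ C) (hf : DifferentiableOn ℂ f C)
    {a b : E} (ha : a ∈ C) (hb : b ∈ C)
    (h : ∃ᶠ t : ℂ in 𝓝[≠] 0, f (AffineMap.lineMap a b t) = 0) : f b = 0 := by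
  set line : ℂ → E := ⇑(AffineMap.lineMap (k := ℂ) a b) with hline
  have hdiff : Differentiable ℂ line := AffineMap.differentiable _
  have hconv' : Convex ℝ (line ⁻¹' C) :=
    (hconv.translate_preimage_left a).linear_preimage
      ((LinearMap.toSpanSingleton ℂ E (b - a)).restrictScalars ℝ)
  have hanalytic : AnalyticOnNhd ℂ (f ∘ line) (line ⁻¹' C) :=
    (hf.comp hdiff.differentiableOn (mapsTo_preimage _ _)).analyticOnNhd
      (hC.preimage hdiff.continuous)
  have hone := hanalytic.eqOn_zero_of_preconnected_of_frequently_eq_zero hconv'.isPreconnected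
    (z₀ := 0) (by simpa [hline]) h (x := 1) (by simpa [hline])
  simpa [hline] using hone

theorem eqOn_zero_of_preconnected_of_eventuallyEq_zero [CompleteSpace F] {f : E → F}
    {U : Set E} (hU : IsOpen U) (hUc : IsPreconnected U) (hf : DifferentiableOn ℂ f U)
    {a : E} (ha : a ∈ U) (h0 : f =ᶠ[𝓝 a] 0) : EqOn f 0 U := by
  have hsub : U ⊆ {p | ∀ᶠ q in 𝓝 p, f q = 0} := by
    refine hUc.subset_of_closure_inter_subset isOpen_setOfPred_eventually_nhds ⟨a, ha, h0⟩ ?_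
    rintro p ⟨hp, hpU⟩
    obtain ⟨R, hR, hball⟩ := Metric.isOpen_iff.1 hU p hpU
    obtain ⟨q, hq, hqR⟩ := Metric.mem_closure_iff.1 hp R hR
    filter_upwards [Metric.ball_mem_nhds p hR] with b hb
    refine eq_zero_of_frequently_lineMap_eq_zero Metric.isOpen_ball (convex_ball p R)
      (hf.mono hball) (Metric.mem_ball'.2 hqR) hb (Eventually.frequently ?_)
    have hline : Tendsto (AffineMap.lineMap q b : ℂ → E) (𝓝 0) (𝓝 q) :=
      AffineMap.lineMap_continuous.tendsto' _ _ (AffineMap.lineMap_apply_zero q b)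
    exact nhdsWithin_le_nhds (hline.eventually hq)
  exact fun p hp => (hsub hp).self_of_nhds

theorem linearIndependent_pair_iff_exists_mul_sub_mul_ne_zero {α β : E →L[ℂ] ℂ} :
    LinearIndependent ℂ ![α, β] ↔ ∃ v w, α v * β w - α w * β v ≠ 0 := by
  rw [LinearIndependent.pair_iff]
  constructor
  · intro h
    by_contra! hzero
    have hβ : β = 0 := by
      ext w
      refine (h (β w) (-α w) ?_).1
      ext v
      simp only [add_apply, smul_apply, zero_apply, smul_eq_mul]
      linear_combination hzero v w
    exact one_ne_zero (h 0 1 (by simp [hβ])).2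
  · rintro ⟨v, w, hvw⟩ s t hst
    have hv : s * α v + t * β v = 0 := by simpa using DFunLike.congr_fun hst v
    have hw : s * α w + t * β w = 0 := by simpa using DFunLike.congr_fun hst w
    exact ⟨(mul_eq_zero.1 (by linear_combination β w * hv - β v * hw)).resolve_right hvw,
      (mul_eq_zero.1 (by linear_combination α v * hw - α w * hv)).resolve_right hvw⟩

theorem not_linearIndependent_fderiv_of_eventually {f g : E → ℂ} {U : Set E} (hU : IsOpen U)
    (hUc : IsPreconnected U) (hf : DifferentiableOn ℂ f U) (hg : DifferentiableOn ℂ g U) {a : E}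
    (ha : a ∈ U) (h0 : ∀ᶠ p in 𝓝 a, ¬ LinearIndependent ℂ ![fderiv ℂ f p, fderiv ℂ g p]) :
    ∀ p ∈ U, ¬ LinearIndependent ℂ ![fderiv ℂ f p, fderiv ℂ g p] := by
  simp only [linearIndependent_pair_iff_exists_mul_sub_mul_ne_zero, not_exists, not_not] at h0 ⊢
  intro p hp v w
  have hdf := differentiableOn_fderiv_apply hU hf
  have hdg := differentiableOn_fderiv_apply hU hg
  exact eqOn_zero_of_preconnected_of_eventuallyEq_zero hU hUc
    (((hdf v).mul (hdg w)).sub ((hdf w).mul (hdg v))) ha (h0.mono fun q h => h v w) hp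

end ComplexAnalysis

section LeafPaths

variable {V : Type*} [NormedAddCommGroup V]

/-- The velocity of `Γ` at each time in `[0, 1]` is a complex multiple of `X`: the path `Γ` runs in
a leaf of the foliation of `X`. -/
def IsLeafPath [NormedSpace ℂ V] (X : V → V) (Γ : ℝ → V) : Prop :=
  ∀ t ∈ Icc (0 : ℝ) 1, ∃ c : ℂ, HasDerivWithinAt Γ (c • X (Γ t)) (Icc 0 1) t

theorem IsFirstIntegralOn.apply_one_eq_apply_zero {X : ℂ × ℂ × ℂ → ℂ × ℂ × ℂ}
    {U : Set (ℂ × ℂ × ℂ)} {F : ℂ × ℂ × ℂ → ℂ} (hF : IsFirstIntegralOn X U F) (hU : IsOpen U)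
    {Γ : ℝ → ℂ × ℂ × ℂ} (hΓ : IsLeafPath X Γ) (hmem : MapsTo Γ (Icc 0 1) U) :
    F (Γ 1) = F (Γ 0) := by
  have hderiv : ∀ t ∈ Icc (0 : ℝ) 1, HasDerivWithinAt (F ∘ Γ) 0 (Icc 0 1) t := by
    intro t ht
    obtain ⟨c, hc⟩ := hΓ t ht
    have hFt := (hF.1.differentiableAt (hU.mem_nhds (hmem ht))).hasFDerivAt.restrictScalars ℝ
    refine (hFt.comp_hasDerivWithinAt t hc).congr_deriv ?_
    rw [ContinuousLinearMap.coe_restrictScalars', map_smul, hF.2 _ (hmem ht), smul_zero]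
  exact constant_of_has_deriv_right_zero (fun t ht => (hderiv t ht).continuousWithinAt)
    (fun t ht => (hderiv t (Ico_subset_Icc_self ht)).mono_of_mem_nhdsWithin
      (Icc_mem_nhdsGE_of_mem ht)) 1 (right_mem_Icc.2 zero_le_one)

theorem eqOn_Icc_of_hasDerivWithinAt_of_locallyLipschitz [NormedSpace ℝ V] {v : V → V}
    (hv : LocallyLipschitz v) {f g : ℝ → V} {a b : ℝ}
    (hf : ∀ t ∈ Icc a b, HasDerivWithinAt f (v (f t)) (Icc a b) t)
    (hg : ∀ t ∈ Icc a b, HasDerivWithinAt g (v (g t)) (Icc a b) t) (h0 : f a = g a) :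
    EqOn f g (Icc a b) := by
  have hfc : ContinuousOn f (Icc a b) := fun t ht => (hf t ht).continuousWithinAt
  have hgc : ContinuousOn g (Icc a b) := fun t ht => (hg t ht).continuousWithinAt
  have hcompact : IsCompact (f '' Icc a b ∪ g '' Icc a b) :=
    (isCompact_Icc.image_of_continuousOn hfc).union (isCompact_Icc.image_of_continuousOn hgc)
  obtain ⟨K, hK⟩ := hv.locallyLipschitzOn.exists_lipschitzOnWith_of_compact hcompact
  exact ODE_solution_unique_of_mem_Icc_right (v := fun _ => v) (fun _ _ => hK)
    hfc (fun t ht => (hf t (Ico_subset_Icc_self ht)).mono_of_mem_nhdsWithin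
      (Icc_mem_nhdsGE_of_mem ht))
    (fun t ht => .inl (mem_image_of_mem f (Ico_subset_Icc_self ht)))
    hgc (fun t ht => (hg t (Ico_subset_Icc_self ht)).mono_of_mem_nhdsWithin
      (Icc_mem_nhdsGE_of_mem ht))
    (fun t ht => .inr (mem_image_of_mem g (Ico_subset_Icc_self ht))) h0

end LeafPaths

section Flow

/-- The resonant monomial `x²yz³`, which satisfies `X(x²yz³) = (x²yz³)²`. -/
def resonance (p : ℂ × ℂ × ℂ) : ℂ := p.1 ^ 2 * p.2.1 * p.2.2 ^ 3

/-- The hyperbolic map `(x, y, z) ↦ (x / (1 - s), y (1 - s), z)`, invertible for `s ≠ 1`. -/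
noncomputable def squeezeMap (s : ℂ) (p : ℂ × ℂ × ℂ) : ℂ × ℂ × ℂ :=
  (p.1 / (1 - s), p.2.1 * (1 - s), p.2.2)

/-- The flow of `fieldX` at complex time `τ`, meaningful as long as `x²yz³ τ` stays away
from `1`. -/
noncomputable def fieldXFlow (τ : ℂ) (p : ℂ × ℂ × ℂ) : ℂ × ℂ × ℂ :=
  squeezeMap (resonance p * τ)
    (p.1 * Complex.exp τ, p.2.1 * Complex.exp τ, p.2.2 * Complex.exp (-τ))

theorem fieldXFlow_zero (p : ℂ × ℂ × ℂ) : fieldXFlow 0 p = p := by simp [fieldXFlow, squeezeMap]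

theorem resonance_fieldXFlow {p : ℂ × ℂ × ℂ} {τ : ℂ} (h : 1 - resonance p * τ ≠ 0) :
    resonance (fieldXFlow τ p) = resonance p / (1 - resonance p * τ) := by
  have hexp : Complex.exp τ * Complex.exp (-τ) = 1 := by simp [← Complex.exp_add]
  simp only [fieldXFlow, squeezeMap, resonance] at h ⊢
  field_simp
  linear_combination (p.1 ^ 2 * p.2.1 * p.2.2 ^ 3 * ((Complex.exp τ * Complex.exp (-τ)) ^ 2 +
    Complex.exp τ * Complex.exp (-τ) + 1)) * hexp

theorem hasDerivAt_fieldXFlow {p : ℂ × ℂ × ℂ} {τ : ℂ} (h : 1 - resonance p * τ ≠ 0) :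
    HasDerivAt (fun σ => fieldXFlow σ p) (fieldX (fieldXFlow τ p)) τ := by
  have hden : HasDerivAt (fun σ : ℂ => 1 - resonance p * σ) (-resonance p) τ := by
    simpa using ((hasDerivAt_id τ).const_mul (resonance p)).const_sub 1
  have hexp := Complex.hasDerivAt_exp τ
  refine (((hexp.const_mul p.1).fun_div hden h).prodMk (((hexp.const_mul p.2.1).fun_mul hden).prodMk
    ((hasDerivAt_neg τ).cexp.const_mul p.2.2))).congr_deriv ?_
  have hres := resonance_fieldXFlow h
  rw [resonance] at hres
  rw [fieldX, hres]
  simp only [fieldXFlow, squeezeMap, Prod.mk.injEq]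
  refine ⟨?_, ?_, ?_⟩
  · field_simp
    ring
  · field_simp
    ring
  · ring

theorem one_sub_mul_ne_zero_of_norm_lt_one {a : ℂ} (h : ‖a‖ < 1) {t : ℝ}
    (ht : t ∈ Icc (0 : ℝ) 1) : 1 - a * t ≠ 0 := by
  rw [sub_ne_zero]
  intro heq
  have hnorm : ‖a‖ * t = 1 := by
    simpa [abs_of_nonneg ht.1] using (congrArg norm heq).symm
  linarith [mul_le_of_le_one_right (norm_nonneg a) ht.2]

theorem hasDerivAt_fieldXFlow_mul_ofReal {p : ℂ × ℂ × ℂ} {c : ℂ} (h : ‖resonance p * c‖ < 1)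
    {t : ℝ} (ht : t ∈ Icc (0 : ℝ) 1) :
    HasDerivAt (fun s : ℝ => fieldXFlow (c * s) p) (c • fieldX (fieldXFlow (c * t) p)) t := by
  have htime : HasDerivAt (fun s : ℝ => c * s) c t := by
    simpa using (Complex.ofRealCLM.hasDerivAt (x := t)).const_mul c
  exact (hasDerivAt_fieldXFlow (by
    rw [← mul_assoc]
    exact one_sub_mul_ne_zero_of_norm_lt_one h ht)).scomp t htime

theorem isLeafPath_fieldXFlow {p : ℂ × ℂ × ℂ} {c : ℂ} (h : ‖resonance p * c‖ < 1) :
    IsLeafPath fieldX (fun t => fieldXFlow (c * t) p) := fun _ ht =>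
  ⟨c, (hasDerivAt_fieldXFlow_mul_ofReal h ht).hasDerivWithinAt⟩

theorem contDiff_fieldX : ContDiff ℝ 1 fieldX := by
  unfold fieldX
  fun_prop

theorem hasDerivWithinAt_lift {Γ : ℝ → ℂ × ℂ} {c : ℂ}
    (hΓ : IsLeafPath fieldX fun t => ((Γ t).1, (Γ t).2, Complex.exp (-(c * t)))) {t : ℝ}
    (ht : t ∈ Icc (0 : ℝ) 1) :
    HasDerivWithinAt (fun t => ((Γ t).1, (Γ t).2, Complex.exp (-(c * t))))
      (c • fieldX ((Γ t).1, (Γ t).2, Complex.exp (-(c * t)))) (Icc 0 1) t := by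
  obtain ⟨a, ha⟩ := hΓ t ht
  have hlift : HasDerivWithinAt (fun s : ℝ => Complex.exp (-(c * s)))
      (a * -Complex.exp (-(c * t))) (Icc 0 1) t :=
    ha.hasFDerivWithinAt.snd.snd.hasDerivWithinAt.congr_deriv (by simp [fieldX])
  have hbase : HasDerivAt (fun s : ℝ => Complex.exp (-(c * s)))
      (Complex.exp (-(c * t)) * -c) t := by
    simpa using ((Complex.ofRealCLM.hasDerivAt (x := t)).const_mul c).neg.cexp
  have heq := (uniqueDiffOn_Icc zero_lt_one t ht).eq_deriv _ hlift hbase.hasDerivWithinAt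
  have hac : a = c := mul_right_cancel₀ (Complex.exp_ne_zero (-(c * t))) (by
    linear_combination -heq)
  rwa [hac] at ha

theorem lift_eq_fieldXFlow {Γ : ℝ → ℂ × ℂ} {c : ℂ}
    (hΓ : IsLeafPath fieldX fun t => ((Γ t).1, (Γ t).2, Complex.exp (-(c * t))))
    (hc : ‖resonance ((Γ 0).1, (Γ 0).2, 1) * c‖ < 1) :
    EqOn (fun t => ((Γ t).1, (Γ t).2, Complex.exp (-(c * t))))
      (fun t => fieldXFlow (c * t) ((Γ 0).1, (Γ 0).2, 1)) (Icc 0 1) :=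
  eqOn_Icc_of_hasDerivWithinAt_of_locallyLipschitz (v := fun p => c • fieldX p)
    (contDiff_fieldX.const_smul c).locallyLipschitz (fun _ ht => hasDerivWithinAt_lift hΓ ht)
    (fun _ ht => (hasDerivAt_fieldXFlow_mul_ofReal hc ht).hasDerivWithinAt)
    (by simp [fieldXFlow_zero])

end Flow

section Germs

theorem pseudoOrbit_subset {α : Type*} {V S : Set α} {φ ψ : α → α} {p : α} (hp : p ∈ S)
    (hφ : ∀ q ∈ S, φ q ∈ V → φ q ∈ S) (hψ : ∀ q ∈ S, ψ q ∈ V → ψ q ∈ S) :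
    pseudoOrbit V φ ψ p ⊆ S := by
  intro q hq
  induction hq with
  | refl => exact hp
  | tail _ hstep ih =>
    obtain ⟨hV, rfl | rfl⟩ := hstep
    exacts [hφ _ ih hV, hψ _ ih hV]

variable {E : Type*} [NormedAddCommGroup E] [NormedSpace ℂ E]

theorem DiffGerm.IsRepresentedBy.congr {g : DiffGerm E} {φ ψ : E → E} (h : g.IsRepresentedBy φ)
    (hφψ : φ =ᶠ[𝓝 0] ψ) : g.IsRepresentedBy ψ := by
  obtain ⟨hφ, hg⟩ := h
  exact ⟨⟨hφ.1.congr hφψ, hφψ.eq_of_nhds ▸ hφ.2⟩, hg.trans (Quotient.sound hφψ)⟩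

end Germs

section Shears

/-- The time-`c` map of the vector field `x²y (x ∂/∂x - y ∂/∂y)` of the plane. -/
noncomputable def shearMap (c : ℂ) (p : ℂ × ℂ) : ℂ × ℂ :=
  (p.1 / (1 - c * (p.1 ^ 2 * p.2)), p.2 * (1 - c * (p.1 ^ 2 * p.2)))

theorem shearMap_zero (p : ℂ × ℂ) : shearMap 0 p = p := by simp [shearMap]

theorem shearMap_add {c : ℂ} (d : ℂ) {p : ℂ × ℂ} (h : 1 - c * (p.1 ^ 2 * p.2) ≠ 0) :
    shearMap (d + c) p = shearMap d (shearMap c p) := by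
  have hden : 1 - d * ((shearMap c p).1 ^ 2 * (shearMap c p).2) =
      (1 - (d + c) * (p.1 ^ 2 * p.2)) / (1 - c * (p.1 ^ 2 * p.2)) := by
    simp only [shearMap]
    generalize hw : p.1 ^ 2 * p.2 = w at h ⊢
    rw [div_pow, eq_div_iff h]
    field_simp
    linear_combination -d * hw
  rw [shearMap, shearMap, hden, shearMap, Prod.mk.injEq, div_div_div_cancel_right₀ h, mul_assoc,
    mul_div_cancel₀ _ h]
  exact ⟨rfl, rfl⟩

theorem eventually_one_sub_ne_zero (c : ℂ) :
    ∀ᶠ p : ℂ × ℂ in 𝓝 0, 1 - c * (p.1 ^ 2 * p.2) ≠ 0 :=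
  ContinuousAt.eventually_ne (by fun_prop) (by simp)

theorem analyticAt_shearMap {c : ℂ} {p : ℂ × ℂ} (h : 1 - c * (p.1 ^ 2 * p.2) ≠ 0) :
    AnalyticAt ℂ (shearMap c) p := by
  have hden : AnalyticAt ℂ (fun q : ℂ × ℂ => 1 - c * (q.1 ^ 2 * q.2)) p :=
    analyticAt_const.sub (analyticAt_const.mul ((analyticAt_fst.pow 2).mul analyticAt_snd))
  exact (analyticAt_fst.div hden h).prod (analyticAt_snd.mul hden)

theorem analyticAt_shearMap_zero_and_fixed (c : ℂ) :
    AnalyticAt ℂ (shearMap c) 0 ∧ shearMap c 0 = 0 :=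
  ⟨analyticAt_shearMap (by simp), by simp [shearMap]⟩

/-- The germs at the origin of the maps `shearMap c`, as a one-parameter group. -/
noncomputable def shearHom : Multiplicative ℂ →* DiffGerm (ℂ × ℂ) :=
  MonoidHom.toHomUnits
    { toFun := fun c => Quotient.mk (LocalHolMap.setoid (ℂ × ℂ))
        ⟨shearMap c.toAdd, analyticAt_shearMap_zero_and_fixed c.toAdd⟩
      map_one' := Quotient.sound (Eventually.of_forall shearMap_zero)
      map_mul' := fun c d => by
        refine Quotient.sound ?_
        filter_upwards [eventually_one_sub_ne_zero d.toAdd] with p hp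
          using shearMap_add c.toAdd hp }

/-- The germ at the origin of `shearMap c`. -/
noncomputable def shearGerm (c : ℂ) : DiffGerm (ℂ × ℂ) := shearHom (.ofAdd c)

theorem shearGerm_neg (c : ℂ) : shearGerm (-c) = (shearGerm c)⁻¹ := by
  rw [shearGerm, ofAdd_neg, map_inv, shearGerm]

theorem isRepresentedBy_shearMap_iff {c : ℂ} {g : DiffGerm (ℂ × ℂ)} :
    g.IsRepresentedBy (shearMap c) ↔ g = shearGerm c :=
  ⟨fun ⟨_, h⟩ => Units.ext h, fun h => ⟨analyticAt_shearMap_zero_and_fixed c, h ▸ rfl⟩⟩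

theorem shearHom_injective : Function.Injective shearHom := by
  refine (injective_iff_map_eq_one _).2 fun c hc => ?_
  have hgerm : ∀ᶠ p in 𝓝 (0 : ℂ × ℂ), shearMap c.toAdd p = p :=
    Quotient.exact (congrArg Units.val hc)
  have hcont : Continuous fun t : ℂ => (t, t) := by fun_prop
  have hdiag : Tendsto (fun t : ℂ => (t, t)) (𝓝[≠] 0) (𝓝 (0 : ℂ × ℂ)) :=
    (hcont.tendsto' 0 0 rfl).mono_left nhdsWithin_le_nhds
  obtain ⟨t, hfix, ht : t ≠ 0⟩ := ((hdiag.eventually hgerm).and self_mem_nhdsWithin).exists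
  have hsnd : t * (1 - c.toAdd * (t ^ 2 * t)) = t := congrArg Prod.snd hfix
  have hzero : c.toAdd * t ^ 4 = 0 := by linear_combination -hsnd
  exact (mul_eq_zero.1 hzero).resolve_right (pow_ne_zero 4 ht)

theorem not_isOfFinOrder_shearGerm {c : ℂ} (hc : c ≠ 0) : ¬ IsOfFinOrder (shearGerm c) := by
  rw [shearGerm, shearHom_injective.isOfFinOrder_iff, isOfFinOrder_iff_eq_one]
  exact hc

theorem hasShearForm_shearGerm (c : ℂ) : HasShearForm (shearGerm c) c := by
  refine ⟨fun u => c / (1 - c * u), AnalyticAt.div (by fun_prop) (by fun_prop) (by simp),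
    by simp, (isRepresentedBy_shearMap_iff.2 rfl).congr ?_⟩
  filter_upwards [eventually_one_sub_ne_zero c] with p hp
  have hfactor : 1 + p.1 ^ 2 * p.2 * (c / (1 - c * (p.1 ^ 2 * p.2))) =
      (1 - c * (p.1 ^ 2 * p.2))⁻¹ := by
    rw [← mul_left_inj' hp, inv_mul_cancel₀ hp, add_mul, mul_assoc, div_mul_cancel₀ _ hp]
    ring
  rw [hfactor, inv_inv, ← div_eq_mul_inv, shearMap]

theorem shearMap_fst_mul_snd {c : ℂ} {p : ℂ × ℂ} (h : 1 - c * (p.1 ^ 2 * p.2) ≠ 0) :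
    (shearMap c p).1 * (shearMap c p).2 = p.1 * p.2 := by
  rw [shearMap, mul_comm p.2, ← mul_assoc, div_mul_cancel₀ _ h]

theorem shearMap_snd (c : ℂ) (p : ℂ × ℂ) : (shearMap c p).2 = p.2 - c * (p.1 * p.2) ^ 2 := by
  rw [shearMap]
  ring

theorem finite_setOf_norm_sub_intCast_mul_lt (a : ℂ) {b : ℂ} (hb : b ≠ 0) (r : ℝ) :
    {n : ℤ | ‖a - n * b‖ < r}.Finite := by
  refine (finite_Icc (-⌈(r + ‖a‖) / ‖b‖⌉) ⌈(r + ‖a‖) / ‖b‖⌉).subset fun n hn => abs_le.1 ?_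
  have hnorm : |(n : ℝ)| * ‖b‖ ≤ r + ‖a‖ := by
    rw [← Complex.norm_intCast, ← norm_mul]
    linarith [norm_le_norm_add_norm_sub a (n * b), mem_ofPred_eq ▸ hn]
  have hle := ((le_div_iff₀ (norm_pos_iff.2 hb)).2 hnorm).trans (Int.le_ceil _)
  exact_mod_cast hle

/-- A neighbourhood of the origin on which `shearMap c` and `shearMap (-c)` are holomorphic and
injective; the bound on the second coordinate makes their orbits finite. -/
def shearDomain (c : ℂ) : Set (ℂ × ℂ) := {p | ‖p.2‖ < 1 ∧ ‖c * (p.1 ^ 2 * p.2)‖ < 1}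

theorem shearDomain_neg (c : ℂ) : shearDomain (-c) = shearDomain c := by simp [shearDomain]

theorem isOpen_shearDomain (c : ℂ) : IsOpen (shearDomain c) :=
  (isOpen_lt (by fun_prop) continuous_const).and (isOpen_lt (by fun_prop) continuous_const)

theorem one_sub_ne_zero_of_mem_shearDomain {c : ℂ} {p : ℂ × ℂ} (hp : p ∈ shearDomain c) :
    1 - c * (p.1 ^ 2 * p.2) ≠ 0 := by
  intro h
  have hlt := hp.2
  rw [← sub_eq_zero.1 h, norm_one] at hlt
  exact lt_irrefl _ hlt

theorem leftInvOn_shearMap (c : ℂ) :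
    LeftInvOn (shearMap (-c)) (shearMap c) (shearDomain c) := fun p hp => by
  rw [← shearMap_add _ (one_sub_ne_zero_of_mem_shearDomain hp), neg_add_cancel, shearMap_zero]

theorem differentiableOn_shearMap (c : ℂ) : DifferentiableOn ℂ (shearMap c) (shearDomain c) :=
  fun _ hp =>
    (analyticAt_shearMap (one_sub_ne_zero_of_mem_shearDomain hp)).differentiableWithinAt

theorem finite_setOf_mem_shearDomain (c y : ℂ) {b k : ℂ} (hb : b ≠ 0) (hk : k ≠ 0) :
    {q ∈ shearDomain c | q.1 * q.2 = k ∧ ∃ n : ℤ, q.2 = y - n * b}.Finite := by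
  refine ((finite_setOf_norm_sub_intCast_mul_lt y hb 1).image
    fun n : ℤ => (k / (y - n * b), y - n * b)).subset ?_
  rintro q ⟨hq, hqk, n, hn⟩
  have hsnd : q.2 ≠ 0 := right_ne_zero_of_mul (hqk ▸ hk)
  refine ⟨n, by simpa [← hn] using hq.1, ?_⟩
  simp only [← hn, ← hqk, mul_div_cancel_right₀ _ hsnd]

theorem finite_pseudoOrbit_shearMap {c : ℂ} (hc : c ≠ 0) {p : ℂ × ℂ} (hp : p ∈ shearDomain c) :
    (pseudoOrbit (shearDomain c) (shearMap c) (shearMap (-c)) p).Finite := by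
  rcases eq_or_ne (p.1 * p.2) 0 with hk | hk
  · have hfix : ∀ d, shearMap d p = p := fun d => by
      have hzero : p.1 ^ 2 * p.2 = 0 := by linear_combination p.1 * hk
      simp [shearMap, hzero]
    refine (finite_singleton p).subset (pseudoOrbit_subset rfl ?_ ?_) <;>
    · rintro q rfl -
      exact hfix _
  · refine (finite_setOf_mem_shearDomain c p.2 (b := c * (p.1 * p.2) ^ 2) (by positivity)
      hk).subset (pseudoOrbit_subset ⟨hp, rfl, 0, by simp⟩ ?_ ?_)
    · rintro q ⟨hq, hqk, n, hn⟩ hqV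
      refine ⟨hqV, (shearMap_fst_mul_snd (one_sub_ne_zero_of_mem_shearDomain hq)).trans hqk,
        n + 1, ?_⟩
      rw [shearMap_snd, hqk, hn]
      push_cast
      ring
    · rintro q ⟨hq, hqk, n, hn⟩ hqV
      rw [← shearDomain_neg] at hq
      refine ⟨hqV, (shearMap_fst_mul_snd (one_sub_ne_zero_of_mem_shearDomain hq)).trans hqk,
        n - 1, ?_⟩
      rw [shearMap_snd, hqk, hn]
      push_cast
      ring

theorem hasFiniteOrbits_shearGerm {c : ℂ} (hc : c ≠ 0) : (shearGerm c).HasFiniteOrbits := by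
  have hright : LeftInvOn (shearMap c) (shearMap (-c)) (shearDomain c) := by
    simpa [shearDomain_neg] using leftInvOn_shearMap (-c)
  exact ⟨shearDomain c, shearMap c, shearMap (-c), isOpen_shearDomain c, by simp [shearDomain],
    isRepresentedBy_shearMap_iff.2 rfl, isRepresentedBy_shearMap_iff.2 (shearGerm_neg c).symm,
    differentiableOn_shearMap c, shearDomain_neg c ▸ differentiableOn_shearMap (-c),
    (leftInvOn_shearMap c).injOn, hright.injOn, fun p hp _ => leftInvOn_shearMap c hp,
    fun p hp _ => hright hp, fun p hp => finite_pseudoOrbit_shearMap hc hp⟩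

end Shears

section Holonomy

theorem resonance_mk_one (p : ℂ × ℂ) : resonance (p.1, p.2, 1) = p.1 ^ 2 * p.2 := by
  simp [resonance]

theorem fieldXFlow_eq_shearMap {c : ℂ} (hc : Complex.exp c = 1) (p : ℂ × ℂ) :
    fieldXFlow c (p.1, p.2, 1) = ((shearMap c p).1, (shearMap c p).2, 1) := by
  simp [fieldXFlow, squeezeMap, shearMap, resonance_mk_one, Complex.exp_neg, hc, mul_comm c]

theorem eventually_norm_resonance_mul_lt_one (c : ℂ) :
    ∀ᶠ p : ℂ × ℂ in 𝓝 0, ‖resonance (p.1, p.2, 1) * c‖ < 1 := by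
  simp only [resonance_mk_one]
  exact ContinuousAt.eventually_lt (by fun_prop) continuousAt_const (by simp)

theorem IsHolonomyGerm.eq_shearGerm {c : ℂ} (hc : Complex.exp c = 1) {g : DiffGerm (ℂ × ℂ)}
    (hg : IsHolonomyGerm fieldX (fun t : ℝ => Complex.exp (-(c * t))) g) : g = shearGerm c := by
  obtain ⟨φ, V, Γ, hφ, hV, -, -, hΓ⟩ := hg
  refine isRepresentedBy_shearMap_iff.1 (hφ.congr ?_)
  filter_upwards [hV, eventually_norm_resonance_mul_lt_one c] with p hp hpc
  obtain ⟨hstart, hend, hlift⟩ := hΓ p hp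
  have hone := lift_eq_fieldXFlow hlift (by rwa [hstart]) (right_mem_Icc.2 zero_le_one)
  simp only [hstart, hend, Complex.ofReal_one, mul_one, fieldXFlow_eq_shearMap hc,
    Prod.mk.injEq] at hone
  exact Prod.ext hone.1 hone.2.1

theorem continuousOn_fieldXFlow_mul_ofReal (c : ℂ) :
    ContinuousOn (fun q : (ℂ × ℂ) × ℝ => fieldXFlow (c * q.2) (q.1.1, q.1.2, 1))
      ({p | ‖resonance (p.1, p.2, 1) * c‖ < 1} ×ˢ Icc 0 1) := by
  have hden : ∀ q ∈ {p : ℂ × ℂ | ‖resonance (p.1, p.2, 1) * c‖ < 1} ×ˢ Icc (0 : ℝ) 1,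
      1 - q.1.1 ^ 2 * q.1.2 * (c * q.2) ≠ 0 := fun q hq => by
    rw [← resonance_mk_one, ← mul_assoc]
    exact one_sub_mul_ne_zero_of_norm_lt_one hq.1 hq.2
  simp only [fieldXFlow, squeezeMap, resonance_mk_one] at hden ⊢
  exact (ContinuousOn.div (by fun_prop) (by fun_prop) hden).prodMk (by fun_prop)

theorem isHolonomyGerm_shearGerm {c : ℂ} (hc : Complex.exp c = 1) :
    IsHolonomyGerm fieldX (fun t : ℝ => Complex.exp (-(c * t))) (shearGerm c) := by
  have hcont := continuousOn_fieldXFlow_mul_ofReal c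
  refine ⟨shearMap c, {p | ‖resonance (p.1, p.2, 1) * c‖ < 1}, fun p t =>
      ((fieldXFlow (c * t) (p.1, p.2, 1)).1, (fieldXFlow (c * t) (p.1, p.2, 1)).2.1),
    isRepresentedBy_shearMap_iff.2 rfl, eventually_norm_resonance_mul_lt_one c,
    hcont.fst.prodMk hcont.snd.fst, fun t _ => by simp [fieldXFlow, squeezeMap], fun p hp =>
    ⟨by simp [fieldXFlow_zero], by simp [fieldXFlow_eq_shearMap hc], ?_⟩⟩
  have hthird : ∀ t : ℝ, ((fieldXFlow (c * t) (p.1, p.2, 1)).1,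
      (fieldXFlow (c * t) (p.1, p.2, 1)).2.1, Complex.exp (-(c * t))) =
        fieldXFlow (c * t) (p.1, p.2, 1) := by
    simp [fieldXFlow, squeezeMap]
  simpa only [IsLeafPath, hthird] using isLeafPath_fieldXFlow hp

theorem isHolonomyGerm_iff {c : ℂ} (hc : Complex.exp c = 1) {g : DiffGerm (ℂ × ℂ)} :
    IsHolonomyGerm fieldX (fun t : ℝ => Complex.exp (-(c * t))) g ↔ g = shearGerm c :=
  ⟨fun hg => hg.eq_shearGerm hc, fun hg => hg ▸ isHolonomyGerm_shearGerm hc⟩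

end Holonomy

section FirstIntegrals

theorem squeezeMap_mem_ball {s : ℂ} (hs : ‖s‖ ≤ 1 / 2) {p : ℂ × ℂ × ℂ} {r : ℝ}
    (hp : p ∈ Metric.ball 0 r) : squeezeMap s p ∈ Metric.ball 0 (2 * r) := by
  rw [mem_ball_zero_iff, Prod.norm_def, Prod.norm_def, max_lt_iff, max_lt_iff] at *
  obtain ⟨hx, hy, hz⟩ := hp
  have hlower : 1 / 2 ≤ ‖1 - s‖ := by linarith [norm_sub_norm_le 1 s, norm_one (α := ℂ)]
  have hupper : ‖1 - s‖ ≤ 2 := by linarith [norm_sub_le 1 s, norm_one (α := ℂ)]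
  refine ⟨?_, ?_, hz.trans_le (by linarith [(norm_nonneg _).trans_lt hz])⟩
  · rw [squeezeMap, norm_div, div_lt_iff₀ (by linarith)]
    nlinarith [norm_nonneg p.1]
  · rw [squeezeMap, norm_mul]
    nlinarith [norm_nonneg p.2.1]

theorem fieldXFlow_mem_ball {p : ℂ × ℂ × ℂ} {τ : ℂ} (hτ : τ.re = 0)
    (hs : ‖resonance p * τ‖ ≤ 1 / 2) {r : ℝ} (hp : p ∈ Metric.ball 0 r) :
    fieldXFlow τ p ∈ Metric.ball 0 (2 * r) := by
  refine squeezeMap_mem_ball hs ?_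
  rw [mem_ball_zero_iff] at hp ⊢
  simpa [Prod.norm_def, Complex.norm_exp, hτ] using hp

theorem squeezeMap_zero (p : ℂ × ℂ × ℂ) : squeezeMap 0 p = p := by simp [squeezeMap]

theorem fieldXFlow_eq_squeezeMap {τ : ℂ} (hτ : Complex.exp τ = 1) (p : ℂ × ℂ × ℂ) :
    fieldXFlow τ p = squeezeMap (resonance p * τ) p := by
  simp [fieldXFlow, Complex.exp_neg, hτ]

theorem differentiable_squeezeMap (s : ℂ) : Differentiable ℂ (squeezeMap s) := by
  unfold squeezeMap
  fun_prop

theorem hasDerivAt_squeezeMap {p : ℂ × ℂ × ℂ} {s : ℂ} (hs : 1 - s ≠ 0) :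
    HasDerivAt (fun s => squeezeMap s p) (p.1 / (1 - s) ^ 2, -p.2.1, 0) s := by
  have hden : HasDerivAt (fun s : ℂ => 1 - s) (-1) s := (hasDerivAt_id s).const_sub 1
  exact (((hasDerivAt_const s p.1).fun_div hden hs).prodMk ((hden.const_mul p.2.1).prodMk
    (hasDerivAt_const s p.2.2))).congr_deriv (by simp)

theorem resonance_lineMap (p : ℂ × ℂ × ℂ) (t : ℂ) :
    resonance (AffineMap.lineMap (0, 0, p.2.2) p t) = t ^ 3 * resonance p := by
  simp only [resonance, AffineMap.lineMap_apply, vsub_eq_sub, vadd_eq_add, Prod.fst_add,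
    Prod.smul_fst, Prod.fst_sub, Prod.snd_add, Prod.smul_snd, Prod.snd_sub, smul_eq_mul]
  ring

namespace IsFirstIntegralOn

variable {U : Set (ℂ × ℂ × ℂ)} {F : ℂ × ℂ × ℂ → ℂ} {r : ℝ} {p : ℂ × ℂ × ℂ}

theorem apply_squeezeMap_of_exp_eq_one (hF : IsFirstIntegralOn fieldX U F) (hU : IsOpen U)
    (hr : Metric.ball 0 (2 * r) ⊆ U) (hp : p ∈ Metric.ball 0 r) {τ : ℂ}
    (hτ : Complex.exp τ = 1) (hs : ‖resonance p * τ‖ ≤ 1 / 2) :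
    F (squeezeMap (resonance p * τ) p) = F p := by
  have hre : τ.re = 0 := by
    rw [← Real.exp_eq_one_iff, ← Complex.norm_exp, hτ, norm_one]
  have hmem : MapsTo (fun t : ℝ => fieldXFlow (τ * t) p) (Icc 0 1) U := fun t ht => by
    refine hr (fieldXFlow_mem_ball (by simp [hre]) ?_ hp)
    rw [← mul_assoc, norm_mul, Complex.norm_real, Real.norm_of_nonneg ht.1]
    exact (mul_le_of_le_one_right (norm_nonneg _) ht.2).trans hs
  have hloop := hF.apply_one_eq_apply_zero hU (isLeafPath_fieldXFlow (by linarith)) hmem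
  simpa [fieldXFlow_eq_squeezeMap hτ, fieldXFlow_zero] using hloop

/- The points `(x / (k n), y / (k n), z)` have resonance `x²yz³ / (k n)³`, so going `n³` times
around the axis squeezes them by an amount independent of `n`; as `n → ∞` they accumulate at
`(0, 0, z)`, and the identity theorem on the line through these points reaches `(x, y, z)`. -/
theorem apply_squeezeMap_div_pow (hF : IsFirstIntegralOn fieldX U F) (hU : IsOpen U)
    (hr : Metric.ball 0 (2 * r) ⊆ U) (hp : p ∈ Metric.ball 0 r) {c : ℂ}
    (hc : Complex.exp c = 1) {k : ℕ} (hk : k ≠ 0) (hs : ‖resonance p * c / k ^ 3‖ ≤ 1 / 2) :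
    F (squeezeMap (resonance p * c / k ^ 3) p) = F p := by
  set s := resonance p * c / k ^ 3 with hs_def
  have hr0 : 0 < r := (norm_nonneg _).trans_lt (mem_ball_zero_iff.1 hp)
  have hbase : ((0, 0, p.2.2) : ℂ × ℂ × ℂ) ∈ Metric.ball 0 r := by
    rw [mem_ball_zero_iff] at hp ⊢
    simp only [Prod.norm_def, norm_zero, max_lt_iff] at hp ⊢
    exact ⟨hr0, hr0, hp.2.2⟩
  have hdiff : DifferentiableOn ℂ (fun q => F (squeezeMap s q) - F q) (Metric.ball 0 r) :=
    (hF.1.comp (differentiable_squeezeMap s).differentiableOn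
      fun q hq => hr (squeezeMap_mem_ball hs hq)).sub
        (hF.1.mono ((Metric.ball_subset_ball (by linarith)).trans hr))
  have hscale : Tendsto (fun n : ℕ => (k * n : ℂ)⁻¹) atTop (𝓝[≠] 0) :=
    tendsto_inv₀_cobounded'.comp
      ((tendsto_mul_left_cobounded (by exact_mod_cast hk)).comp tendsto_natCast_atTop_cobounded)
  have hline : Tendsto (AffineMap.lineMap (0, 0, p.2.2) p : ℂ → ℂ × ℂ × ℂ) (𝓝 0)
      (𝓝 (0, 0, p.2.2)) :=
    AffineMap.lineMap_continuous.tendsto' _ _ (AffineMap.lineMap_apply_zero _ _)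
  have hnear : ∀ᶠ n : ℕ in atTop,
      AffineMap.lineMap (0, 0, p.2.2) p (k * n : ℂ)⁻¹ ∈ Metric.ball (0 : ℂ × ℂ × ℂ) r :=
    (hline.comp (hscale.mono_right nhdsWithin_le_nhds)).eventually
      (Metric.isOpen_ball.mem_nhds hbase)
  refine sub_eq_zero.1 (eq_zero_of_frequently_lineMap_eq_zero Metric.isOpen_ball
    (convex_ball 0 r) hdiff hbase hp (hscale.frequently (Eventually.frequently ?_)))
  filter_upwards [hnear, eventually_ne_atTop 0] with n hn hn0
  have hres : resonance (AffineMap.lineMap (0, 0, p.2.2) p (k * n : ℂ)⁻¹) * ((n ^ 3 : ℕ) * c) =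
      s := by
    rw [resonance_lineMap, hs_def, Nat.cast_pow]
    field_simp
  have hwind := hF.apply_squeezeMap_of_exp_eq_one hU hr hn (τ := (n ^ 3 : ℕ) * c)
    (by rw [Complex.exp_nat_mul, hc, one_pow]) (by rwa [hres])
  rwa [hres, ← sub_eq_zero] at hwind

theorem eventually_apply_squeezeMap_eq (hF : IsFirstIntegralOn fieldX U F) (hU : IsOpen U)
    (hr : Metric.ball 0 (2 * r) ⊆ U) (hp : p ∈ Metric.ball 0 r) (hw : resonance p ≠ 0) :
    ∀ᶠ s in 𝓝 0, F (squeezeMap s p) = F p := by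
  set a := resonance p * (2 * Real.pi * Complex.I)
  have ha0 : a ≠ 0 := mul_ne_zero hw Complex.two_pi_I_ne_zero
  have hdiff : DifferentiableOn ℂ (fun s => F (squeezeMap s p)) (Metric.ball 0 (1 / 2)) := by
    refine hF.1.comp (fun s hs => ?_) fun s hs =>
      hr (squeezeMap_mem_ball (mem_ball_zero_iff.1 hs).le hp)
    have hs1 : 1 - s ≠ 0 := fun h => by
      rw [← sub_eq_zero.1 h, mem_ball_zero_iff, norm_one] at hs
      linarith
    exact (hasDerivAt_squeezeMap hs1).differentiableAt.differentiableWithinAt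
  have hanalytic : AnalyticAt ℂ (fun s => F (squeezeMap s p)) 0 :=
    hdiff.analyticAt (Metric.ball_mem_nhds 0 (by norm_num))
  refine (hanalytic.frequently_eq_iff_eventually_eq analyticAt_const).1 ?_
  have hsmall : Tendsto (fun k : ℕ => a / k ^ 3) atTop (𝓝[≠] 0) := by
    refine (tendsto_inv₀_cobounded'.comp ((tendsto_mul_left_cobounded (inv_ne_zero ha0)).comp
      (tendsto_natCast_atTop_cobounded.comp (tendsto_pow_atTop three_ne_zero)))).congr fun k => ?_
    simp [div_eq_mul_inv, mul_comm]
  refine hsmall.frequently (Eventually.frequently ?_)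
  filter_upwards [eventually_ne_atTop 0,
    hsmall.eventually (nhdsWithin_le_nhds (Metric.closedBall_mem_nhds 0 one_half_pos))]
    with k hk0 hk
  exact hF.apply_squeezeMap_div_pow hU hr hp Complex.exp_two_pi_mul_I hk0
    (mem_closedBall_zero_iff.1 hk)

theorem fderiv_apply_hyperbolic_eq_zero (hF : IsFirstIntegralOn fieldX U F) (hU : IsOpen U)
    (hr : Metric.ball 0 (2 * r) ⊆ U) (hp : p ∈ Metric.ball 0 r) (hw : resonance p ≠ 0) :
    fderiv ℂ F p (p.1, -p.2.1, 0) = 0 := by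
  have hr0 : 0 < r := (norm_nonneg _).trans_lt (mem_ball_zero_iff.1 hp)
  have hpU : p ∈ U := hr (Metric.ball_subset_ball (by linarith) hp)
  have hderiv := (hF.1.differentiableAt (hU.mem_nhds hpU)).hasFDerivAt.comp_hasDerivAt_of_eq 0
    (hasDerivAt_squeezeMap (p := p) (by simp)) (squeezeMap_zero p).symm
  have hconst := (hasDerivAt_const (0 : ℂ) (F p)).congr_of_eventuallyEq
    (hF.eventually_apply_squeezeMap_eq hU hr hp hw)
  simpa using hderiv.unique hconst

end IsFirstIntegralOn

/-- The monomial `xyz²`, a first integral of `fieldX`. -/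
def invariantMonomial (p : ℂ × ℂ × ℂ) : ℂ := p.1 * p.2.1 * p.2.2 ^ 2

theorem differentiable_invariantMonomial : Differentiable ℂ invariantMonomial := by
  unfold invariantMonomial
  fun_prop

theorem fderiv_invariantMonomial_apply (p v : ℂ × ℂ × ℂ) :
    fderiv ℂ invariantMonomial p v =
      v.1 * (p.2.1 * p.2.2 ^ 2) + v.2.1 * (p.1 * p.2.2 ^ 2) +
        v.2.2 * (2 * p.1 * p.2.1 * p.2.2) := by
  have hfst : HasFDerivAt (fun p : ℂ × ℂ × ℂ => p.1) (.fst ℂ ℂ (ℂ × ℂ)) p := hasFDerivAt_fst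
  have hsnd : HasFDerivAt (fun p : ℂ × ℂ × ℂ => p.2) (.snd ℂ ℂ (ℂ × ℂ)) p := hasFDerivAt_snd
  have hderiv : HasFDerivAt invariantMonomial _ p :=
    (hfst.fun_mul hsnd.fst).fun_mul (hsnd.snd.pow 2)
  rw [hderiv.fderiv]
  simp only [Nat.add_one_sub_one, pow_one, nsmul_eq_mul, Nat.cast_ofNat, smul_add, add_apply,
    smul_apply, ContinuousLinearMap.comp_apply, ContinuousLinearMap.coe_snd', smul_eq_mul,
    ContinuousLinearMap.coe_fst']
  ring

theorem isFirstIntegralOn_invariantMonomial : IsFirstIntegralOn fieldX univ invariantMonomial := by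
  refine ⟨differentiable_invariantMonomial.differentiableOn, fun p _ => ?_⟩
  rw [fderiv_invariantMonomial_apply, fieldX]
  ring

theorem frequently_invariantMonomial_ne_zero : ∃ᶠ p in 𝓝 0, invariantMonomial p ≠ 0 := by
  have hcont : Continuous fun t : ℂ => (t, t, t) := by fun_prop
  have hdiag : Tendsto (fun t : ℂ => (t, t, t)) (𝓝[≠] 0) (𝓝 0) :=
    (hcont.tendsto' 0 0 rfl).mono_left nhdsWithin_le_nhds
  refine hdiag.frequently (Eventually.frequently ?_)
  filter_upwards [self_mem_nhdsWithin] with t ht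
  exact mul_ne_zero (mul_ne_zero ht ht) (pow_ne_zero 2 ht)

theorem not_eventually_invariantMonomial_eq :
    ¬ ∃ c : ℂ, ∀ᶠ p in 𝓝 0, invariantMonomial p = c := by
  rintro ⟨c, hc⟩
  have hc0 : invariantMonomial 0 = c := hc.self_of_nhds
  obtain ⟨p, hp, hpc⟩ := (frequently_invariantMonomial_ne_zero.and_eventually hc).exists
  exact hp (hpc.trans (hc0.symm.trans (by simp [invariantMonomial])))

theorem IsFirstIntegralOn.exists_fderiv_eq_smul {U : Set (ℂ × ℂ × ℂ)} {F : ℂ × ℂ × ℂ → ℂ}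
    (hF : IsFirstIntegralOn fieldX U F) (hU : IsOpen U) {r : ℝ} (hr : Metric.ball 0 (2 * r) ⊆ U)
    {p : ℂ × ℂ × ℂ} (hp : p ∈ Metric.ball 0 r) (hJ : invariantMonomial p ≠ 0) :
    ∃ k : ℂ, fderiv ℂ F p = k • fderiv ℂ invariantMonomial p := by
  have hr0 : 0 < r := (norm_nonneg _).trans_lt (mem_ball_zero_iff.1 hp)
  obtain ⟨⟨hx, hy⟩, hz⟩ : (p.1 ≠ 0 ∧ p.2.1 ≠ 0) ∧ p.2.2 ≠ 0 := by
    simpa [invariantMonomial] using hJ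
  have hlin : ∀ v : ℂ × ℂ × ℂ, fderiv ℂ F p v = v.1 * fderiv ℂ F p (1, 0, 0) +
      v.2.1 * fderiv ℂ F p (0, 1, 0) + v.2.2 * fderiv ℂ F p (0, 0, 1) := fun v => by
    simp only [← smul_eq_mul, ← map_smul, ← map_add]
    simp
  have hhyp := hF.fderiv_apply_hyperbolic_eq_zero hU hr hp (by simp [resonance, hx, hy, hz])
  have hfield := hF.2 p (hr (Metric.ball_subset_ball (by linarith) hp))
  rw [hlin] at hhyp hfield
  simp only [fieldX] at hhyp hfield
  refine ⟨fderiv ℂ F p (1, 0, 0) / (p.2.1 * p.2.2 ^ 2), ContinuousLinearMap.ext fun v => ?_⟩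
  rw [smul_apply, smul_eq_mul, fderiv_invariantMonomial_apply, hlin]
  generalize fderiv ℂ F p (1, 0, 0) = a at *
  generalize fderiv ℂ F p (0, 1, 0) = b at *
  generalize fderiv ℂ F p (0, 0, 1) = d at *
  have hb : b = a * p.1 / p.2.1 := by
    rw [eq_div_iff hy]
    linear_combination -hhyp
  have hd : d = 2 * a * p.1 / p.2.2 := by
    rw [eq_div_iff hz]
    linear_combination -hfield + (p.1 ^ 2 * p.2.1 * p.2.2 ^ 3 - 1) * hhyp
  rw [hb, hd]
  field_simp

theorem not_independentOn_of_isFirstIntegralOn {U : Set (ℂ × ℂ × ℂ)} (hU : IsOpen U)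
    (hUc : IsPreconnected U) (h0 : (0 : ℂ × ℂ × ℂ) ∈ U) {F G : ℂ × ℂ × ℂ → ℂ}
    (hF : IsFirstIntegralOn fieldX U F) (hG : IsFirstIntegralOn fieldX U G) :
    ¬ IndependentOn U F G := by
  rintro ⟨p, hp, hli⟩
  obtain ⟨R, hR, hball⟩ := Metric.isOpen_iff.1 hU 0 h0
  obtain ⟨r, hr, rfl⟩ : ∃ r : ℝ, 0 < r ∧ R = 2 * r := ⟨R / 2, half_pos hR, by ring⟩
  obtain ⟨a, haJ, ha⟩ := (frequently_invariantMonomial_ne_zero.and_eventually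
    (Metric.ball_mem_nhds 0 hr)).exists
  refine not_linearIndependent_fderiv_of_eventually hU hUc hF.1 hG.1
    (hball (Metric.ball_subset_ball (by linarith) ha)) ?_ p hp hli
  filter_upwards [Metric.isOpen_ball.mem_nhds ha,
    differentiable_invariantMonomial.continuous.continuousAt.eventually_ne haJ] with q hq hqJ
  obtain ⟨k, hk⟩ := hF.exists_fderiv_eq_smul hU hball hq hqJ
  obtain ⟨l, hl⟩ := hG.exists_fderiv_eq_smul hU hball hq hqJ
  rw [linearIndependent_pair_iff_exists_mul_sub_mul_ne_zero, hk, hl]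
  rintro ⟨v, w, hvw⟩
  refine hvw ?_
  simp only [smul_apply, smul_eq_mul]
  ring

end FirstIntegrals

theorem mainTheorem5 :
    -- no two independent holomorphic first integrals, on any connected neighbourhood of the origin
    (¬ ∃ U : Set (ℂ × ℂ × ℂ), IsOpen U ∧ IsConnected U ∧ (0 : ℂ × ℂ × ℂ) ∈ U ∧
      ∃ F G : ℂ × ℂ × ℂ → ℂ, IsFirstIntegralOn fieldX U F ∧ IsFirstIntegralOn fieldX U G ∧
        IndependentOn U F G) ∧
    -- one holomorphic first integral on the whole space, not constant near the origin
    (∃ F : ℂ × ℂ × ℂ → ℂ, IsFirstIntegralOn fieldX Set.univ F ∧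
      ¬ ∃ c : ℂ, ∀ᶠ p in 𝓝 (0 : ℂ × ℂ × ℂ), F p = c) ∧
    -- the holonomy `h` of the loop `z = exp(2πit)`, and that of the reversed loop, which is `h⁻¹`
    ∃ h : DiffGerm (ℂ × ℂ),
      (∀ g : DiffGerm (ℂ × ℂ),
        IsHolonomyGerm fieldX (fun t : ℝ => Complex.exp (2 * Real.pi * Complex.I * t)) g ↔
          g = h) ∧
      (∀ g : DiffGerm (ℂ × ℂ),
        IsHolonomyGerm fieldX (fun t : ℝ => Complex.exp (-(2 * Real.pi * Complex.I * t))) g ↔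
          g = h⁻¹) ∧
      HasShearForm h (-(2 * Real.pi * Complex.I)) ∧
      HasShearForm h⁻¹ (2 * Real.pi * Complex.I) ∧
      h.HasFiniteOrbits ∧ h⁻¹.HasFiniteOrbits ∧
      (Subgroup.zpowers h : Set (DiffGerm (ℂ × ℂ))).Infinite ∧
      ¬ IsOfFinOrder h := by
  have hc : (2 * Real.pi * Complex.I : ℂ) ≠ 0 := Complex.two_pi_I_ne_zero
  have hexp : Complex.exp (2 * Real.pi * Complex.I) = 1 := Complex.exp_two_pi_mul_I
  have hexp_neg : Complex.exp (-(2 * Real.pi * Complex.I)) = 1 := by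
    rw [Complex.exp_neg, hexp, inv_one]
  have hinv : (shearGerm (-(2 * Real.pi * Complex.I)))⁻¹ = shearGerm (2 * Real.pi * Complex.I) := by
    rw [shearGerm_neg, inv_inv]
  have horder := not_isOfFinOrder_shearGerm (neg_ne_zero.2 hc)
  refine ⟨fun ⟨U, hU, hUc, h0, F, G, hF, hG, hFG⟩ =>
      not_independentOn_of_isFirstIntegralOn hU hUc.isPreconnected h0 hF hG hFG,
    ⟨invariantMonomial, isFirstIntegralOn_invariantMonomial, not_eventually_invariantMonomial_eq⟩,
    shearGerm (-(2 * Real.pi * Complex.I)), fun g => ?_, ?_⟩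
  · simpa only [neg_mul, neg_neg] using isHolonomyGerm_iff hexp_neg
  · rw [hinv]
    exact ⟨fun _ => isHolonomyGerm_iff hexp, hasShearForm_shearGerm _, hasShearForm_shearGerm _,
      hasFiniteOrbits_shearGerm (neg_ne_zero.2 hc), hasFiniteOrbits_shearGerm hc,
      infinite_zpowers.2 horder, horder⟩
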